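/- Let $M$ be a smooth finite-dimensional Riemannian manifold (without boundary) with Riemannian distance $d$. A geodesic is a smooth curve $\gamma:[0,1]\to M$ with $\gamma''=0$ (covariant derivative of the Levi-Civita connection); it is minimizing if its length is $d(\gamma(0),\gamma(1))$. Let $C\subset M$ be compact and uniquely geodesically convex, that is: any two points $x,y\in C$ are joined by a minimizing geodesic contained in $C$, and there is only one geodesic from $x$ to $y$ that is contained in $C$. For $x\in C$ let $C_x$ be the set of $v\in T_xM$ such that $t\mapsto \operatorname{Exp}_x(tv)$ is defined on $[0,1]$, minimizing, and contained in $C$; then $\operatorname{Exp}_x:C_x\to C$ is bijective, and $\operatorname{Exp}_x^{-1}:C\to C_x$ denotes its inverse. Let $\alpha>0$ and assume that $C$ is Riemannian $\alpha$-strongly convex: for every $x\in C$ the set $S=\operatorname{Exp}_x^{-1}(C)\subset T_xM$ is $\alpha$-strongly convex for the norm $\|\cdot\|_x$, that is, $$(1-t)u+tu'+\alpha(1-t)t\,\|u-u'\|_x^2\,z\in S\qquad\text{for all } u,u'\in S,\ t\in[0,1],\ z\in T_xM \text{ with } \|z\|_x=1.$$ Then $C$ satisfies the Riemannian scaling inequality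 with the same constant $\alpha$: for every $x\in C$, every $w\in T_xM$ and every $v\in\operatorname{argmax}_{z\in C}\langle w,\operatorname{Exp}_x^{-1}(z)\rangle_x$, $$\langle w,\operatorname{Exp}_x^{-1}(v)\rangle_x\ \ge\ \alpha\,\|w\|_x\,\|\operatorname{Exp}_x^{-1}(v)\|_x^2 .$$ -/

import Mathlib

open Set Bundle Manifold
open scoped ContDiff ENNReal

noncomputable section

namespace RiemannianSets

variable (E : Type*) [NormedAddCommGroup E] [NormedSpace ℝ E]
  {M : Type*} [EMetricSpace M] [ChartedSpace E M]
  [RiemannianBundle (fun x : M ↦ TangentSpace 𝓘(ℝ, E) x)]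

/-- The Riemannian metric read in the preferred chart around `p`: the bilinear form `g_y(a, b)` at
the chart coordinate `y`, where `a` and `b` are constant vectors in the chart. -/
def chartMetric (p : M) (y a b : E) : ℝ :=
  inner ℝ
    (mfderiv 𝓘(ℝ, E) 𝓘(ℝ, E) (extChartAt 𝓘(ℝ, E) p).symm y a)
    (mfderiv 𝓘(ℝ, E) 𝓘(ℝ, E) (extChartAt 𝓘(ℝ, E) p).symm y b)

/-- The Christoffel symbols of the first kind of the Levi-Civita connection, in the preferred chart
around `p`: `g_y(∇_a b, u) = (∂_a g(b, u) + ∂_b g(a, u) - ∂_u g(a, b)) / 2` for the coordinate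
vector fields `a`, `b`, `u`. -/
def chartChristoffel (p : M) (y a b u : E) : ℝ :=
  (fderiv ℝ (fun y' ↦ chartMetric E p y' b u) y a
    + fderiv ℝ (fun y' ↦ chartMetric E p y' a u) y b
    - fderiv ℝ (fun y' ↦ chartMetric E p y' a b) y u) / 2

/-- For a curve `γ` on `[0,1]`, the number `g(γ''(t), u)`, where `γ''` is the covariant derivative
of `γ'` along `γ`, computed in the preferred chart around `γ t`; `u` is a tangent vector at `γ t` in
the coordinates of this chart. -/
def covariantAcceleration (γ : ℝ → M) (t : ℝ) (u : E) : ℝ :=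
  let c : ℝ → E := fun s ↦ extChartAt 𝓘(ℝ, E) (γ t) (γ s)
  let c' : ℝ → E := derivWithin c (Icc 0 1)
  let c'' : ℝ → E := derivWithin c' (Icc 0 1)
  chartMetric E (γ t) (c t) (c'' t) u + chartChristoffel E (γ t) (c t) (c' t) (c' t) u

/-- `γ : [0,1] → M` is a geodesic: a smooth curve with `γ'' = 0`. (The values of `γ` outside
`[0,1]` are irrelevant.) -/
def IsGeodesic (γ : ℝ → M) : Prop :=
  ContMDiffOn 𝓘(ℝ, ℝ) 𝓘(ℝ, E) ∞ γ (Icc 0 1) ∧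
    ∀ t ∈ Icc (0 : ℝ) 1, ∀ u : E, covariantAcceleration E γ t u = 0

/-- The initial velocity `γ'(0)` of a curve on `[0,1]`, together with its base point `γ(0)`, as an
element of the tangent bundle. -/
def initialVelocity (γ : ℝ → M) : TangentBundle 𝓘(ℝ, E) M :=
  ⟨γ 0, mfderivWithin 𝓘(ℝ, ℝ) 𝓘(ℝ, E) γ (Icc 0 1) 0 (1 : ℝ)⟩

/-- `γ` is the curve `t ↦ Exp_x(t v)` on `[0,1]`: the geodesic with `γ(0) = x` and `γ'(0) = v`.
In particular, `Exp_x(v) = γ(1)`. -/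
def IsExpCurve (x : M) (v : TangentSpace 𝓘(ℝ, E) x) (γ : ℝ → M) : Prop :=
  IsGeodesic E γ ∧ initialVelocity E γ = ⟨x, v⟩

/-- The curve `γ` on `[0,1]` is distance minimizing: its length is the distance of its ends. -/
def IsMinimizing (γ : ℝ → M) : Prop :=
  pathELength 𝓘(ℝ, E) γ 0 1 = edist (γ 0) (γ 1)

/-- `C` is (geodesically) convex: any two of its points are joined by a distance minimizing geodesic
that is contained in `C`. -/
def IsGeodesicallyConvex (C : Set M) : Prop :=
  ∀ x ∈ C, ∀ y ∈ C, ∃ γ : ℝ → M, IsGeodesic E γ ∧ γ 0 = x ∧ γ 1 = y ∧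
    IsMinimizing E γ ∧ MapsTo γ (Icc 0 1) C

/-- `C` is uniquely geodesic: between any two of its points there is only one geodesic that is
contained in `C`. -/
def IsUniquelyGeodesic (C : Set M) : Prop :=
  ∀ x ∈ C, ∀ y ∈ C, ∀ γ₁ γ₂ : ℝ → M,
    (IsGeodesic E γ₁ ∧ γ₁ 0 = x ∧ γ₁ 1 = y ∧ MapsTo γ₁ (Icc 0 1) C) →
    (IsGeodesic E γ₂ ∧ γ₂ 0 = x ∧ γ₂ 1 = y ∧ MapsTo γ₂ (Icc 0 1) C) →
    EqOn γ₁ γ₂ (Icc 0 1)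

/-- `C` is uniquely geodesically convex. -/
def IsUniquelyGeodesicallyConvex (C : Set M) : Prop :=
  IsGeodesicallyConvex E C ∧ IsUniquelyGeodesic E C

/-- `v ∈ C_x` and `Exp_x(v) = z`: the curve `t ↦ Exp_x(t v)` on `[0,1]` is minimizing, is contained
in `C` and ends at `z`. -/
def IsLog (C : Set M) (x z : M) (v : TangentSpace 𝓘(ℝ, E) x) : Prop :=
  ∃ γ : ℝ → M, IsExpCurve E x v γ ∧ IsMinimizing E γ ∧ MapsTo γ (Icc 0 1) C ∧ γ 1 = z

open Classical in
/-- The logarithm `Exp_x⁻¹(z)` relative to `C`. If `C` is uniquely geodesically convex, then for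
`x, z ∈ C` it is the only vector `v` with `IsLog E C x z v`. -/
def logMap (C : Set M) (x z : M) : TangentSpace 𝓘(ℝ, E) x :=
  if h : ∃ v, IsLog E C x z v then h.choose else 0

/-- Euclidean `α`-strong convexity of a subset of a real inner product space. -/
def IsEuclideanStronglyConvex {V : Type*} [NormedAddCommGroup V] [InnerProductSpace ℝ V]
    (α : ℝ) (S : Set V) : Prop :=
  0 < α ∧ ∀ x ∈ S, ∀ y ∈ S, ∀ t ∈ Icc (0 : ℝ) 1, ∀ z : V, ‖z‖ = 1 →
    (1 - t) • x + t • y + (α * (1 - t) * t * ‖x - y‖ ^ 2) • z ∈ S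

/-- `C` is Riemannian `α`-strongly convex: for every `x ∈ C`, the set `Exp_x⁻¹(C)` is `α`-strongly
convex in the Euclidean space `T_x M`. -/
def IsRiemannianStronglyConvex (α : ℝ) (C : Set M) : Prop :=
  0 < α ∧ ∀ x ∈ C, IsEuclideanStronglyConvex α (logMap E C x '' C)

/-- The Riemannian scaling inequality for `C` with constant `α`. -/
def RiemannianScalingInequality (α : ℝ) (C : Set M) : Prop :=
  0 < α ∧ ∀ x ∈ C, ∀ w : TangentSpace 𝓘(ℝ, E) x, ∀ v ∈ C,
    IsMaxOn (fun z ↦ inner ℝ w (logMap E C x z)) C v →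
    α * ‖w‖ * ‖logMap E C x v‖ ^ 2 ≤ inner ℝ w (logMap E C x v)

end RiemannianSets

end

namespace RiemannianSets

section Geodesic

variable {E : Type*} [NormedAddCommGroup E] [NormedSpace ℝ E]
  {M : Type*} [EMetricSpace M] [ChartedSpace E M]
  [RiemannianBundle (fun x : M ↦ TangentSpace 𝓘(ℝ, E) x)]

/-! The inequality lives in a single tangent space. The strongly convex set `S = Exp_x⁻¹(C)`
contains `0 = Exp_x⁻¹(x)`, because a geodesic loop in `C` must be constant (`logMap_self`). If `v`
maximizes `⟨w, ·⟩` on `S`, comparing it with `t v + α(1-t)t‖v‖² w/‖w‖ ∈ S` gives `(1-t)⟨w,v⟩ ≥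
α(1-t)t‖w‖‖v‖²`; divide by `1-t` and let `t → 1` (`IsEuclideanStronglyConvex.scaling`). -/

theorem chartMetric_zero_left (p : M) (y b : E) : chartMetric E p y 0 b = 0 := by
  unfold chartMetric
  erw [map_zero, inner_zero_left]

theorem chartChristoffel_zero (p : M) (y u : E) : chartChristoffel E p y 0 0 u = 0 := by
  simp [chartChristoffel, chartMetric_zero_left]

theorem isGeodesic_const (x : M) : IsGeodesic E (fun _ : ℝ ↦ x) := by
  refine ⟨contMDiffOn_const, fun t _ u ↦ ?_⟩
  simp [covariantAcceleration, chartMetric_zero_left, chartChristoffel_zero]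

/-- An exponential curve that is constant on `[0,1]` has zero initial velocity. -/
theorem IsExpCurve.eq_zero_of_eqOn_const {x : M} {v : TangentSpace 𝓘(ℝ, E) x} {γ : ℝ → M}
    (hγ : IsExpCurve E x v γ) (h : EqOn γ (fun _ ↦ x) (Icc 0 1)) : v = 0 := by
  -- Identifying the base points turns the heterogeneous equality of fibre vectors into an ordinary
  -- one.
  have h0 : γ 0 = x := h (left_mem_Icc.2 zero_le_one)
  subst h0
  have hv : mfderivWithin 𝓘(ℝ, ℝ) 𝓘(ℝ, E) γ (Icc 0 1) 0 (1 : ℝ) = v :=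
    eq_of_heq (TotalSpace.mk.inj hγ.2).2
  rw [← hv]
  have hconst : mfderivWithin 𝓘(ℝ, ℝ) 𝓘(ℝ, E) γ (Icc 0 1) 0 = 0 := by
    refine (HasMFDerivWithinAt.congr_of_eventuallyEq
      (hasMFDerivWithinAt_const (I := 𝓘(ℝ, ℝ)) (I' := 𝓘(ℝ, E)) (γ 0) (Icc (0 : ℝ) 1) 0)
      (h.eventuallyEq_of_mem self_mem_nhdsWithin) rfl).mfderivWithin ?_
    exact (uniqueDiffOn_Icc_zero_one 0 (left_mem_Icc.2 zero_le_one)).uniqueMDiffWithinAt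
  rw [hconst]
  rfl

/-- The constant curve is a geodesic in `C` from `x` to `x`, so by uniqueness it is the only one. -/
theorem logMap_self {C : Set M} (hC : IsUniquelyGeodesic E C) {x : M} (hx : x ∈ C) :
    logMap E C x x = 0 := by
  unfold logMap
  split_ifs with h
  · obtain ⟨γ, hγ, -, hmaps, hend⟩ := h.choose_spec
    have hstart : γ 0 = x := congrArg TotalSpace.proj hγ.2
    exact hγ.eq_zero_of_eqOn_const <| hC x hx x hx γ (fun _ ↦ x)
      ⟨hγ.1, hstart, hend, hmaps⟩ ⟨isGeodesic_const x, rfl, rfl, fun _ _ ↦ hx⟩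
  -- Without a logarithm, the default value of `logMap` is already `0`.
  · rfl

end Geodesic

/-- The scaling inequality at the origin of a strongly convex set in an inner product space. -/
theorem IsEuclideanStronglyConvex.scaling {V : Type*} [NormedAddCommGroup V]
    [InnerProductSpace ℝ V] {α : ℝ} {S : Set V} (hS : IsEuclideanStronglyConvex α S)
    (h0 : (0 : V) ∈ S) {w v : V} (hv : v ∈ S) (hmax : ∀ u ∈ S, inner ℝ w u ≤ inner ℝ w v) :
    α * ‖w‖ * ‖v‖ ^ 2 ≤ inner ℝ w v := by
  rcases eq_or_ne w 0 with rfl | hw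
  · simp
  have hw' : ‖w‖ ≠ 0 := norm_ne_zero_iff.2 hw
  -- At `t = 1` the comparison degenerates to `0 ≤ 0`, so the factor `1 - t` is cancelled for `t <
  -- 1` and the endpoint is reached as a limit.
  have hlt : ∀ t ∈ Ico (0 : ℝ) 1, t * (α * ‖w‖ * ‖v‖ ^ 2) ≤ inner ℝ w v := by
    intro t ht
    have hz : ‖‖w‖⁻¹ • w‖ = 1 := norm_smul_inv_norm (𝕜 := ℝ) hw
    -- Strong convexity on the segment from `0` to `v`, pushed in the direction `w/‖w‖`.
    have h := hmax _ (hS.2 0 h0 v hv t ⟨ht.1, ht.2.le⟩ _ hz)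
    have hwz : ‖w‖⁻¹ * ‖w‖ ^ 2 = ‖w‖ := by field_simp
    simp only [smul_zero, zero_add, zero_sub, norm_neg, inner_add_right, inner_smul_right,
      real_inner_self_eq_norm_sq, hwz] at h
    have ht' : 0 < 1 - t := sub_pos.2 ht.2
    refine le_of_mul_le_mul_left ?_ ht'
    linarith
  have hlim : Filter.Tendsto (fun t : ℝ ↦ t * (α * ‖w‖ * ‖v‖ ^ 2)) (nhdsWithin 1 (Iio 1))
      (nhds (1 * (α * ‖w‖ * ‖v‖ ^ 2))) :=
    (Continuous.tendsto (by fun_prop) 1).mono_left nhdsWithin_le_nhds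
  rw [one_mul] at hlim
  refine le_of_tendsto hlim ?_
  filter_upwards [Ico_mem_nhdsLT (zero_lt_one' ℝ)] with t ht using hlt t ht

end RiemannianSets

theorem mainTheorem7
    {E : Type*} [NormedAddCommGroup E] [NormedSpace ℝ E] [FiniteDimensional ℝ E]
    {M : Type*} [EMetricSpace M] [ChartedSpace E M] [IsManifold 𝓘(ℝ, E) ∞ M]
    [RiemannianBundle (fun x : M ↦ TangentSpace 𝓘(ℝ, E) x)]
    [IsContMDiffRiemannianBundle 𝓘(ℝ, E) ∞ E (fun x : M ↦ TangentSpace 𝓘(ℝ, E) x)]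
    [IsRiemannianManifold 𝓘(ℝ, E) M]
    (C : Set M) (hcompact : IsCompact C)
    (hconvex : RiemannianSets.IsUniquelyGeodesicallyConvex E C)
    (α : ℝ) (hstrong : RiemannianSets.IsRiemannianStronglyConvex E α C) :
    RiemannianSets.RiemannianScalingInequality E α C := by
  refine ⟨hstrong.1, fun x hx w v hv hmax ↦ ?_⟩
  refine (hstrong.2 x hx).scaling ⟨x, hx, RiemannianSets.logMap_self hconvex.2 hx⟩
    (mem_image_of_mem _ hv) ?_
  rintro _ ⟨z, hz, rfl⟩
  exact hmax hz
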